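/- Let $R$ be an associative unital ring; modules are left $R$-modules, and an embedding is an injective homomorphism. Let $\gamma(R)$ be the least infinite cardinal $\kappa$ such that every left ideal of $R$ is generated by fewer than $\kappa$ elements. For modules $N\subseteq M$, say that $M$ is universal over $N$ if $|M|=|N|$ and for every module $N^*\supseteq N$ with $|N^*|=|M|$ there is an embedding $N^*\to M$ that is the identity on $N$. For an infinite cardinal $\lambda$ and a limit ordinal $\alpha<\lambda^+$, a $(\lambda,\alpha)$-limit model is a module $M=\bigcup_{i<\alpha}M_i$, where $(M_i)_{i<\alpha}$ is an increasing chain of modules of cardinality $\lambda$ with $M_i=\bigcup_{j<i}M_j$ for every limit ordinal $i<\alpha$, and $M_{i+1}$ is universal over $M_i$ for every $i<\alpha$. The class of $R$-modules with embeddings is stable in $\lambda$ if a $(\lambda,\alpha)$-limit model exists for some limit ordinal $\alpha<\lambda^+$. Let $\lambda$ be a regular (infinite) cardinal with $\lambda\ge |R|$ and $\lambda\ge\gamma(R)^+$ such that the class of $R$-modules with embeddings is stable in $\lambda$. Then for every regular (infinite) cardinal $\alpha<\lambda^+$ the $(\lambda,\alpha)$-limit model exists and is unique up to isomorphism, and $$\{\alpha<\lambda^+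 : \alpha \text{ is a regular cardinal and the } (\lambda,\alpha)\text{-limit model is isomorphic to the } (\lambda,\lambda)\text{-limit model}\}=[\gamma(R),\lambda^+)\cap\mathrm{Reg},$$ where $\mathrm{Reg}$ is the class of regular (infinite) cardinals and $[\gamma(R),\lambda^+)$ is the set of cardinals $\mu$ with $\gamma(R)\le\mu<\lambda^+$. -/

import Mathlib

universe u

namespace ModuleLimit

open Cardinal

/-- The left ideal `I` is generated by fewer than `κ` elements. For a possibly noncommutative
ring, `Ideal R` is the type of left ideals. -/
def IsLTGenerated {R : Type u} [Ring R] (κ : Cardinal.{u}) (I : Ideal R) : Prop :=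
  ∃ s : Set R, #s < κ ∧ Ideal.span s = I

/-- The least infinite cardinal `κ` such that every left ideal of `R` is generated by
fewer than `κ` elements. -/
noncomputable def gamma (R : Type u) [Ring R] : Cardinal.{u} :=
  sInf {κ : Cardinal.{u} | ℵ₀ ≤ κ ∧ ∀ I : Ideal R, IsLTGenerated κ I}

/-- The infimum defining `gamma R` is attained (the set of such cardinals is nonempty). -/
theorem gamma_spec (R : Type u) [Ring R] :
    ℵ₀ ≤ gamma R ∧ ∀ I : Ideal R, IsLTGenerated (gamma R) I := by
  refine csInf_mem (s := {κ : Cardinal.{u} | ℵ₀ ≤ κ ∧ ∀ I : Ideal R, IsLTGenerated κ I})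
    ⟨Order.succ (max #R ℵ₀), ?_, fun I => ⟨(I : Set R), ?_, Ideal.span_eq I⟩⟩
  · exact (le_max_right _ _).trans (Order.le_succ _)
  · exact Order.lt_succ_of_le ((mk_set_le _).trans (le_max_left _ _))

/-- `M` is universal over `N`, where `N` is regarded as a submodule of `M` through the
embedding `i`: the two have the same cardinality, and every extension `j : N → P` of `N` of that
cardinality embeds into `M` over `N`. -/
def IsUniversalOver {R : Type u} [Ring R] {N M : Type u} [AddCommGroup N] [Module R N]
    [AddCommGroup M] [Module R M] (i : N →ₗ[R] M) : Prop :=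
  #M = #N ∧ Function.Injective i ∧
    ∀ (P : Type u) [AddCommGroup P] [Module R P], #P = #M →
      ∀ j : N →ₗ[R] P, Function.Injective j →
        ∃ f : P →ₗ[R] M, Function.Injective f ∧ f ∘ₗ j = i

/-- `M` is a `(lam, a)`-limit model over its submodule `N`, where `lam` is an infinite cardinal
and `a < lam⁺` is a limit ordinal. The chain is `c i` for `i < a`; values of `c` at `i ≥ a` are
irrelevant. -/
def IsLimitModelOver {R : Type u} [Ring R] {M : Type u} [AddCommGroup M] [Module R M]
    (lam : Cardinal.{u}) (a : Ordinal.{u}) (N : Submodule R M) : Prop :=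
  ℵ₀ ≤ lam ∧ Order.IsSuccLimit a ∧ a < (Order.succ lam).ord ∧
    ∃ c : Ordinal.{u} → Submodule R M,
      (∀ i < a, #(c i) = lam) ∧
      (∀ i j, i ≤ j → j < a → c i ≤ c j) ∧
      (∀ i < a, Order.IsSuccLimit i → (c i : Set M) = ⋃ j < i, (c j : Set M)) ∧
      c 0 = N ∧
      (Set.univ : Set M) = ⋃ i < a, (c i : Set M) ∧
      ∀ i < a, ∃ h : c i ≤ c (Order.succ i), IsUniversalOver (Submodule.inclusion h)

/-- `M` is a `(lam, a)`-limit model. -/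
def IsLimitModel (R : Type u) [Ring R] (lam : Cardinal.{u}) (a : Ordinal.{u})
    (M : Type u) [AddCommGroup M] [Module R M] : Prop :=
  ∃ N : Submodule R M, IsLimitModelOver lam a N

/-- The class of left `R`-modules with embeddings is stable in `lam`: there is a
`lam`-limit model. -/
def IsStableIn (R : Type u) [Ring R] (lam : Cardinal.{u}) : Prop :=
  ∃ (M : ModuleCat.{u} R) (a : Ordinal.{u}), IsLimitModel R lam a M

/-- Some `(lam, a)`-limit model is isomorphic to some `(lam, b)`-limit model. (Where limit models
exist and are unique up to isomorphism, this says that *the* two limit models are isomorphic.) -/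
def LimitModelsIso (R : Type u) [Ring R] (lam : Cardinal.{u}) (a b : Ordinal.{u}) : Prop :=
  ∃ M N : ModuleCat.{u} R,
    IsLimitModel R lam a M ∧ IsLimitModel R lam b N ∧ Nonempty (M ≃ₗ[R] N)

end ModuleLimit

namespace ModuleLimit

open Cardinal Order

/-! Limit models of different lengths are told apart by injectivity: for regular `κ ≤ lam`, the
`(lam, κ)`-limit model is an injective module exactly when `gamma R ≤ κ`. Everything rests on
amalgamation: pushouts of modules embed into universal extensions, with no identifications beyond
the forced ones (`IsUniversalOver.amalgamate`).

If `gamma R ≤ κ`, a homomorphism from a left ideal has fewer than `κ` values on generators, so it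
lands in one stage of the chain and extends at the next; Baer's criterion applies
(`IsLimitChain.injective`). If `κ < gamma R`, a left ideal that is not `<κ`-generated carries a
homomorphism whose values leave every stage, and such a map cannot extend to `R`
(`IsLimitChain.gamma_le_of_injective`). Two limit models of size `lam` embed in each other, so
Bumby's theorem identifies the injective ones (`nonempty_equiv_of_injective_of_embeddings`).

Uniqueness for a fixed length is a back-and-forth along the two chains
(`IsLimitChain.nonempty_equiv`). For existence, stability bounds the number of partial homomorphisms
from `R` into small modules, so small injective extensions exist; adding an independent copy of a
module containing all small modules makes them universal (`exists_isLimitChain`). -/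

/-- Transfinite construction of an increasing continuous chain in a complete lattice. -/
theorem exists_transfinite_chain {L : Type*} [CompleteLattice L] (a : Ordinal.{u})
    (P : Ordinal.{u} → L → Prop) (Q : Ordinal.{u} → L → L → Prop) (x₀ : L) (h0 : P 0 x₀)
    (hs : ∀ i < a, ∀ x, P i x → ∃ y, x ≤ y ∧ P (succ i) y ∧ Q i x y)
    (hl : ∀ i ≤ a, IsSuccLimit i → ∀ x : Ordinal.{u} → L, Monotone x →
      (∀ j < i, P j (x j)) → P i (⨆ j, ⨆ (_ : j < i), x j)) :
    ∃ x : Ordinal.{u} → L, Monotone x ∧ x 0 = x₀ ∧ (∀ i ≤ a, P i (x i)) ∧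
      (∀ i < a, Q i (x i) (x (succ i))) ∧
      ∀ i ≤ a, IsSuccLimit i → x i = ⨆ j, ⨆ (_ : j < i), x j := by
  classical
  -- Outside `P` the step is the identity, so the chain is monotone on all ordinals and monotonicity
  -- is available before `P` is verified.
  let step : Ordinal.{u} → L → L := fun i x =>
    if h : ∃ y, x ≤ y ∧ P (succ i) y ∧ Q i x y then h.choose else x
  have step_le : ∀ i x, x ≤ step i x := by
    intro i x
    by_cases h : ∃ y, x ≤ y ∧ P (succ i) y ∧ Q i x y
    · simp only [step, dif_pos h]
      exact h.choose_spec.1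
    · simp only [step, dif_neg h, le_refl]
  have step_spec : ∀ i < a, ∀ x, P i x → P (succ i) (step i x) ∧ Q i x (step i x) := by
    intro i hi x hx
    have h := hs i hi x hx
    simp only [step, dif_pos h]
    exact h.choose_spec.2
  let x : Ordinal.{u} → L := fun i => SuccOrder.limitRecOn i (fun _ _ => x₀)
    (fun i _ y => step i y) (fun i _ f => ⨆ j, ⨆ (h : j < i), f j h)
  have hx0 : x 0 = x₀ := SuccOrder.limitRecOn_isMin _ _ _ isMin_bot
  have hxs : ∀ i, x (succ i) = step i (x i) := fun i => SuccOrder.limitRecOn_succ _ _ _ _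
  have hxl : ∀ i, IsSuccLimit i → x i = ⨆ j, ⨆ (_ : j < i), x j :=
    fun i hi => SuccOrder.limitRecOn_of_isSuccLimit _ _ _ hi
  have hmono : Monotone x := by
    intro i j
    induction j using SuccOrder.limitRecOn with
    | isMin j hj => intro h; rw [hj.eq_of_le h]
    | succ j _ ih =>
      intro h
      rcases h.lt_or_eq with h | rfl
      · rw [hxs]
        exact (ih (lt_succ_iff.1 h)).trans (step_le _ _)
      · exact le_rfl
    | isSuccLimit j hj _ =>
      intro h
      rcases h.lt_or_eq with h | rfl
      · rw [hxl j hj]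
        exact le_iSup₂_of_le i h le_rfl
      · exact le_rfl
  have hP : ∀ i ≤ a, P i (x i) := by
    intro i
    induction i using SuccOrder.limitRecOn with
    | isMin j hj =>
      intro _
      obtain rfl : j = 0 := hj.eq_bot
      rwa [hx0]
    | succ j _ ih =>
      intro h
      have h' : j < a := succ_le_iff.1 h
      rw [hxs]
      exact (step_spec j h' _ (ih h'.le)).1
    | isSuccLimit j hj ih =>
      intro h
      rw [hxl j hj]
      exact hl j h hj x hmono fun k hk => ih k hk (hk.le.trans h)
  refine ⟨x, hmono, hx0, hP, fun i hi => ?_, fun i _ => hxl i⟩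
  rw [hxs]
  exact (step_spec i hi _ (hP i hi.le)).2

/-! ### Unions of chains of submodules and cardinal bounds -/

variable {R : Type u} [Ring R]

theorem mem_biSup_of_monotone {M : Type*} [AddCommGroup M] [Module R M]
    {x : Ordinal.{u} → Submodule R M} (hx : Monotone x) {i : Ordinal.{u}} (hi : 0 < i) {y : M} :
    y ∈ (⨆ j, ⨆ (_ : j < i), x j) ↔ ∃ j < i, y ∈ x j := by
  have : Nonempty (Set.Iio i) := ⟨⟨0, hi⟩⟩
  have h : (⨆ j, ⨆ (_ : j < i), x j) = ⨆ j : Set.Iio i, x j := by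
    rw [iSup_subtype]; rfl
  rw [h, Submodule.mem_iSup_of_directed _
    (Monotone.directed_le fun (j k : Set.Iio i) (hjk : j ≤ k) => hx hjk)]
  simp

theorem isSuccLimit_pos {i : Ordinal.{u}} (h : IsSuccLimit i) : 0 < i :=
  bot_lt_iff_ne_bot.2 h.ne_bot

theorem mk_biSup_le {M : Type u} [AddCommGroup M] [Module R M]
    {x : Ordinal.{u} → Submodule R M} (hx : Monotone x) {i : Ordinal.{u}} (hi : 0 < i)
    {lam : Cardinal.{u}} (hlam : ℵ₀ ≤ lam) (hil : i.card ≤ lam) (h : ∀ j < i, #(x j) ≤ lam) :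
    #(⨆ j, ⨆ (_ : j < i), x j : Submodule R M) ≤ lam := by
  have : ((⨆ j, ⨆ (_ : j < i), x j : Submodule R M) : Set M) = ⋃ j < i, (x j : Set M) := by
    ext y
    simpa using mem_biSup_of_monotone hx hi
  change #((⨆ j, ⨆ (_ : j < i), x j : Submodule R M) : Set M) ≤ lam
  rw [this]
  exact mk_biUnion_le_of_le hil hlam _ h

theorem mk_span_le {M : Type u} [AddCommGroup M] [Module R M] {lam : Cardinal.{u}}
    (hlam : ℵ₀ ≤ lam) (hR : #R ≤ lam) {s : Set M} (hs : #s ≤ lam) :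
    #(Submodule.span R s) ≤ lam := by
  have h1 : #(Submodule.span R s) ≤ #(s →₀ R) := by
    have : Submodule.span R s = LinearMap.range (Finsupp.linearCombination R ((↑) : s → M)) := by
      rw [Finsupp.range_linearCombination, Subtype.range_coe]
    rw [this]
    exact mk_le_of_surjective (LinearMap.surjective_rangeRestrict _)
  have h2 : #(s →₀ R) ≤ #(Finset (s × R)) :=
    mk_le_of_injective (Finsupp.graph_injective s R)
  obtain ⟨T, rfl⟩ : ∃ T : Type u, #T = lam := ⟨_, mk_out lam⟩
  have : Infinite T := infinite_iff.2 hlam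
  obtain ⟨t⟩ : #(s × R) ≤ #T := by
    rw [mk_prod, lift_id, lift_id]
    exact (mul_le_mul' hs hR).trans (mul_eq_self hlam).le
  exact h1.trans (h2.trans ((mk_le_of_injective (Finset.map_injective t)).trans
    (mk_finset_of_infinite T).le))

/-! ### Amalgamation and its consequences -/

/-- Amalgamation over a universal extension. -/
theorem IsUniversalOver.amalgamate {N M B C : Type u} [AddCommGroup N] [Module R N]
    [AddCommGroup M] [Module R M] [AddCommGroup B] [Module R B] [AddCommGroup C] [Module R C]
    {h : N →ₗ[R] M} (hu : IsUniversalOver h) (hN : ℵ₀ ≤ #N) (hC : #C ≤ #N)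
    (k : B →ₗ[R] C) (hk : Function.Injective k) (e : B →ₗ[R] N) :
    ∃ g : C →ₗ[R] M, (∀ b, g (k b) = h (e b)) ∧ ∀ c n, g c = h n → ∃ b, k b = c ∧ e b = n := by
  obtain ⟨hcard, -, huniv⟩ := hu
  -- `(N × C) ⧸ D` is the pushout of `e` and `k`. As `k` is injective, so is the map from `N`, even
  -- when `e` is not.
  let D : Submodule R (N × C) := LinearMap.range (e.prod (-k))
  let j : N →ₗ[R] (N × C) ⧸ D := D.mkQ ∘ₗ LinearMap.inl R N C
  let q : C →ₗ[R] (N × C) ⧸ D := D.mkQ ∘ₗ LinearMap.inr R N C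
  have hjq : ∀ c n, q c = j n → ∃ b, k b = c ∧ e b = n := by
    intro c n hcn
    have : ((n, -c) : N × C) ∈ D := by
      have := (Submodule.Quotient.eq D).1 hcn.symm
      simpa [LinearMap.inl_apply, LinearMap.inr_apply] using this
    obtain ⟨b, hb⟩ := this
    exact ⟨b, neg_injective (congrArg Prod.snd hb), congrArg Prod.fst hb⟩
  have hj : Function.Injective j := by
    rw [injective_iff_map_eq_zero]
    intro n hn
    obtain ⟨b, hb, hb'⟩ := hjq 0 n (by rw [hn, map_zero])
    rw [← hb', hk (hb.trans (map_zero k).symm), map_zero]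
  have hP : #((N × C) ⧸ D) = #M := by
    rw [hcard]
    apply le_antisymm
    · refine (mk_le_of_surjective D.mkQ_surjective).trans ?_
      rw [mk_prod, lift_id, lift_id]
      exact (mul_le_mul' le_rfl hC).trans (mul_eq_self hN).le
    · exact mk_le_of_injective hj
  obtain ⟨f, hf, hfj⟩ := huniv _ hP j hj
  refine ⟨f ∘ₗ q, fun b => ?_, fun c n hcn => hjq c n (hf ?_)⟩
  · rw [← hfj]
    simp only [LinearMap.comp_apply]
    congr 1
    refine ((Submodule.Quotient.eq D).2 ?_)
    refine ⟨-b, ?_⟩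
    ext <;> simp
  · rw [← hfj] at hcn
    exact hcn

/-- A universal extension contains a copy of every module of at most the given cardinality. -/
theorem IsUniversalOver.exists_embedding {N M C : Type u} [AddCommGroup N] [Module R N]
    [AddCommGroup M] [Module R M] [AddCommGroup C] [Module R C]
    {h : N →ₗ[R] M} (hu : IsUniversalOver h) (hN : ℵ₀ ≤ #N) (hC : #C ≤ #N) :
    ∃ g : C →ₗ[R] M, Function.Injective g := by
  -- Amalgamating over the zero module: the images of `C` and `N` meet only in `0`, which forces a
  -- trivial kernel.
  obtain ⟨g, -, hg⟩ := hu.amalgamate hN hC (0 : PUnit.{u + 1} →ₗ[R] C)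
    (fun _ _ _ => Subsingleton.elim _ _) 0
  refine ⟨g, (injective_iff_map_eq_zero g).2 fun c hc => ?_⟩
  obtain ⟨b, hb, -⟩ := hg c 0 (by rw [hc, map_zero])
  rw [← hb, LinearMap.zero_apply]

/-- If `M` is universal over `N` and every small module embeds in `N`, then there are few
partial homomorphisms from `R` to a small module. -/
theorem mk_linearPMap_le {N M : Type u} [AddCommGroup N] [Module R N]
    [AddCommGroup M] [Module R M] {h : N →ₗ[R] M} (hu : IsUniversalOver h) (hN : ℵ₀ ≤ #N)
    (hR : #R ≤ #N) {C : Type u} [AddCommGroup C] [Module R C] (j : C →ₗ[R] N)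
    (hj : Function.Injective j) : #(R →ₗ.[R] C) ≤ #N := by
  -- Amalgamating `R` with `N` over the domain of `f` codes `f` by the image `m` of `1`: the graph
  -- of `f` can be read off from `m`.
  have key : ∀ f : R →ₗ.[R] C, ∃ m : M, ∀ r : R, ∀ c : C,
      r • m = h (j c) ↔ ∃ hr : r ∈ f.domain, f ⟨r, hr⟩ = c := by
    intro f
    obtain ⟨g, hg, hg'⟩ := hu.amalgamate hN hR (B := f.domain) f.domain.subtype
      f.domain.injective_subtype (j ∘ₗ f.toFun)
    refine ⟨g 1, fun r c => ?_⟩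
    rw [← map_smul, smul_eq_mul, mul_one]
    constructor
    · intro hr
      obtain ⟨b, rfl, hb⟩ := hg' _ _ hr
      exact ⟨b.2, hj hb⟩
    · rintro ⟨hr, rfl⟩
      exact hg ⟨r, hr⟩
  choose F hF using key
  rw [← hu.1]
  refine mk_le_of_injective (f := F) fun f f' hff => ?_
  have hdom : ∀ r c, (∃ hr : r ∈ f.domain, f ⟨r, hr⟩ = c) ↔
      ∃ hr : r ∈ f'.domain, f' ⟨r, hr⟩ = c := fun r c => by
    rw [← hF, ← hF, hff]
  refine LinearPMap.ext ?_ ?_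
  · ext r
    exact ⟨fun hr => ((hdom r _).1 ⟨hr, rfl⟩).1, fun hr => ((hdom r _).2 ⟨hr, rfl⟩).1⟩
  · intro r h1 h2
    exact ((hdom r _).1 ⟨h1, rfl⟩).2.symm

/-! ### Injective modules and Bumby's theorem -/

/-- An injective module extends homomorphisms along injective homomorphisms. -/
theorem exists_extension_of_injective {Q : Type u} [AddCommGroup Q] [Module R Q]
    (hQ : Module.Injective R Q) {X Y : Type u} [AddCommGroup X] [Module R X] [AddCommGroup Y]
    [Module R Y] (f : X →ₗ[R] Y) (hf : Function.Injective f) (g : X →ₗ[R] Q) :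
    ∃ h : Y →ₗ[R] Q, ∀ x, h (f x) = g x :=
  hQ.out f hf g

theorem injective_of_retract {A B : Type u} [AddCommGroup A] [Module R A] [AddCommGroup B]
    [Module R B] (hA : Module.Injective R A) (i : B →ₗ[R] A) (p : A →ₗ[R] B)
    (h : ∀ b, p (i b) = b) : Module.Injective R B where
  out X Y _ _ _ _ f hf g := by
    obtain ⟨l, hl⟩ := hA.out f hf (i ∘ₗ g)
    exact ⟨p ∘ₗ l, fun x => by simp [hl, h]⟩

/-- `E` is an essential extension of `K` inside an ambient module. -/
def IsEssentialIn {B : Type u} [AddCommGroup B] [Module R B] (K E : Submodule R B) : Prop :=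
  K ≤ E ∧ ∀ x ∈ E, x ≠ 0 → ∃ r : R, r • x ∈ K ∧ r • x ≠ 0

/-- Every submodule of an injective module is essential in a direct summand. -/
theorem exists_essential_summand {B : Type u} [AddCommGroup B] [Module R B]
    (hB : Module.Injective R B) (K : Submodule R B) :
    ∃ E : Submodule R B, IsEssentialIn K E ∧ ∃ p : B →ₗ[R] E, ∀ x : E, p x = x := by
  obtain ⟨E, -, hE⟩ := zorn_le_nonempty₀ {E : Submodule R B | IsEssentialIn K E} (by
    intro c hc hch y hy
    refine ⟨sSup c, ⟨(hc hy).1.trans (le_sSup hy), fun x hx hx0 => ?_⟩, fun z hz => le_sSup hz⟩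
    obtain ⟨E, hE, hxE⟩ := (Submodule.mem_sSup_of_directed ⟨y, hy⟩ hch.directedOn).1 hx
    exact (hc hE).2 x hxE hx0) K ⟨le_rfl, fun x hx hx0 => ⟨1, by simpa using ⟨hx, hx0⟩⟩⟩
  obtain ⟨Y, -, hY⟩ := zorn_le_nonempty₀ {Y : Submodule R B | ∀ x ∈ Y, x ∈ E → x = 0} (by
    intro c hc hch y hy
    refine ⟨sSup c, fun x hx hxE => ?_, fun z hz => le_sSup hz⟩
    obtain ⟨Y, hY, hxY⟩ := (Submodule.mem_sSup_of_directed ⟨y, hy⟩ hch.directedOn).1 hx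
    exact hc hY x hxY hxE) ⊥ (fun x hx _ => (Submodule.mem_bot R).1 hx)
  -- Maximality of `Y` makes the image of `E` essential in `B ⧸ Y`.
  have hess : ∀ z : B ⧸ Y, z ≠ 0 → ∃ r : R, ∃ e ∈ E, e ≠ 0 ∧ r • z = Y.mkQ e := by
    intro z hz
    obtain ⟨b, rfl⟩ := Y.mkQ_surjective z
    have hb : b ∉ Y := fun h => hz ((Submodule.Quotient.mk_eq_zero Y).2 h)
    have hlt : ¬ (Y ⊔ Submodule.span R {b} ≤ Y) := fun h =>
      hb (h (Submodule.mem_sup_right (Submodule.mem_span_singleton_self b)))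
    have hnot : ¬ ∀ x ∈ Y ⊔ Submodule.span R {b}, x ∈ E → x = 0 := fun h =>
      hlt (hY.le_of_ge h le_sup_left)
    push Not at hnot
    obtain ⟨e, he, heE, he0⟩ := hnot
    obtain ⟨y, hy, w, hw, rfl⟩ := Submodule.mem_sup.1 he
    obtain ⟨r, rfl⟩ := Submodule.mem_span_singleton.1 hw
    refine ⟨r, _, heE, he0, ?_⟩
    rw [map_add, map_smul, (Submodule.Quotient.mk_eq_zero Y).2 hy |> fun h => (h : Y.mkQ y = 0),
      zero_add]
  have hinj : Function.Injective (Y.mkQ ∘ₗ E.subtype) := by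
    rw [injective_iff_map_eq_zero]
    intro e he
    exact Subtype.ext (hY.prop _ ((Submodule.Quotient.mk_eq_zero Y).1 he) e.2)
  obtain ⟨t, ht⟩ := exists_extension_of_injective hB _ hinj E.subtype
  have ht' : ∀ e ∈ E, t (Y.mkQ e) = e := fun e he => ht ⟨e, he⟩
  -- The range of `t` contains `E` and is still essential over `K`, so maximality of `E` applies.
  have hrange : LinearMap.range t ≤ E := by
    refine hE.le_of_ge (y := LinearMap.range t) ⟨?_, ?_⟩ ?_
    · exact fun x hx => ⟨Y.mkQ x, ht' x (hE.prop.1 hx)⟩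
    · rintro _ ⟨z, rfl⟩ hz0
      obtain ⟨r, e, heE, he0, hr⟩ := hess z (fun h => hz0 (by rw [h, map_zero]))
      obtain ⟨s, hs, hs0⟩ := hE.prop.2 e heE he0
      have : (s * r) • t z = s • e := by rw [mul_smul, ← map_smul t, hr, ht' e heE]
      exact ⟨s * r, by rwa [this], by rwa [this]⟩
    · exact fun x hx => ⟨Y.mkQ x, ht' x hx⟩
  refine ⟨E, hE.prop, (t ∘ₗ Y.mkQ).codRestrict E fun x => hrange ⟨_, rfl⟩, fun x => ?_⟩
  exact Subtype.ext (ht' x x.2)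

/-- A retraction splits a module as the product of the kernel and the retract. -/
noncomputable def equivKerProd {A B : Type u} [AddCommGroup A] [Module R A] [AddCommGroup B]
    [Module R B] (i : B →ₗ[R] A) (p : A →ₗ[R] B) (h : ∀ b, p (i b) = b) :
    (LinearMap.ker p × B) ≃ₗ[R] A :=
  LinearEquiv.ofBijective ((LinearMap.ker p).subtype.coprod i) (by
    constructor
    · rw [injective_iff_map_eq_zero]
      rintro ⟨c, b⟩ hcb
      simp only [LinearMap.coprod_apply, Submodule.subtype_apply] at hcb
      have hc : p c = 0 := c.2
      have hb : b = 0 := by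
        have := congrArg p hcb
        rwa [map_add, hc, zero_add, h, map_zero] at this
      subst hb
      rw [map_zero, add_zero] at hcb
      exact Prod.ext (Subtype.ext hcb) rfl
    · intro a
      refine ⟨(⟨a - i (p a), ?_⟩, p a), ?_⟩
      · rw [LinearMap.mem_ker, map_sub, h, sub_self]
      · simp)

/-- Bumby's theorem: injective modules that embed in each other are isomorphic. -/
theorem nonempty_equiv_of_injective_of_embeddings {A B : Type u} [AddCommGroup A] [Module R A]
    [AddCommGroup B] [Module R B] (hA : Module.Injective R A) (hB : Module.Injective R B)
    (f : A →ₗ[R] B) (hf : Function.Injective f) (g : B →ₗ[R] A) (hg : Function.Injective g) :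
    Nonempty (A ≃ₗ[R] B) := by
  obtain ⟨p, hp⟩ := exists_extension_of_injective hB g hg LinearMap.id
  have hp : ∀ b, p (g b) = b := hp
  let C := LinearMap.ker p
  let h : A →ₗ[R] A := g ∘ₗ f
  -- A Cantor–Bernstein orbit: `X = C + g K`, so `(c, k) ↦ f (c + g k)` maps `C × K` onto `f X = K`.
  -- The essential summand `E` over `K` then inherits `C × E ≃ E`.
  let X : Submodule R A := ⨆ n : ℕ, C.map (h ^ n)
  let K : Submodule R B := X.map f
  have hX : X ≤ C ⊔ K.map g := by
    refine iSup_le fun n => ?_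
    rcases n with _ | n
    · rw [pow_zero]
      exact (Submodule.map_id C).le.trans le_sup_left
    · refine le_trans ?_ le_sup_right
      rintro _ ⟨c, hc, rfl⟩
      rw [pow_succ']
      exact ⟨_, ⟨_, Submodule.mem_iSup_of_mem n ⟨c, hc, rfl⟩, rfl⟩, rfl⟩
  have hCX : C ≤ X := by
    refine le_trans ?_ (le_iSup (fun n : ℕ => C.map (h ^ n)) 0)
    rw [pow_zero]
    exact (Submodule.map_id C).ge
  have hKX : K.map g ≤ X := by
    rintro _ ⟨_, ⟨x, hx, rfl⟩, rfl⟩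
    change h x ∈ X
    have : X ≤ X.comap h := by
      refine iSup_le fun n => ?_
      rintro _ ⟨c, hc, rfl⟩
      refine Submodule.mem_iSup_of_mem (n + 1) ⟨c, hc, ?_⟩
      rw [pow_succ']
      rfl
    exact this hx
  obtain ⟨E, ⟨hKE, hess⟩, r, hr⟩ := exists_essential_summand hB K
  have hCinj : Module.Injective R C := by
    refine injective_of_retract hA C.subtype
      ((LinearMap.id - g ∘ₗ p).codRestrict C fun a => ?_) fun c => ?_
    · refine Subtype.ext ?_
      have : p c = 0 := c.2
      simp [this]
    · change p _ = 0
      simp [hp]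
  have hEinj : Module.Injective R E := injective_of_retract hB E.subtype r hr
  let e := equivKerProd g p hp
  let φ : (C × E) →ₗ[R] B := f ∘ₗ e.toLinearMap ∘ₗ LinearMap.prodMap LinearMap.id E.subtype
  have hφ : ∀ c e, φ (c, e) = f (c + g e) := fun c e => rfl
  have hφinj : Function.Injective φ :=
    hf.comp (e.injective.comp (Prod.map_injective.2
      ⟨Function.injective_id, E.injective_subtype⟩))
  let ψ : (C × E) →ₗ[R] E := r ∘ₗ φ
  have hψK : ∀ c : C, ∀ k : E, (k : B) ∈ K → (ψ (c, k) : B) = φ (c, k) := by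
    intro c k hk
    have : φ (c, k) ∈ K := ⟨_, X.add_mem (hCX c.2) (hKX ⟨_, hk, rfl⟩), rfl⟩
    exact congrArg Subtype.val (hr ⟨_, hKE this⟩)
  -- On `C × K` the map is `φ`, hence injective; a nonzero `x` in `E` has a nonzero multiple in `K`,
  -- which reduces to that case.
  have hψinj : Function.Injective ψ := by
    have h0 : ∀ c : C, ∀ k : E, (k : B) ∈ K → ψ (c, k) = 0 → (c, k) = 0 := by
      intro c k hk h0
      apply hφinj
      rw [← hψK c k hk, h0, map_zero]
      rfl
    rw [injective_iff_map_eq_zero]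
    rintro ⟨c, x⟩ hcx
    by_cases hx : (x : B) = 0
    · exact h0 c x (by rw [hx]; exact K.zero_mem) hcx
    · obtain ⟨s, hs, hs0⟩ := hess x x.2 hx
      have := h0 (s • c) (s • x) hs (by rw [← Prod.smul_mk, map_smul, hcx, smul_zero])
      exact absurd (congrArg (fun y : C × E => (y.2 : B)) this) hs0
  have hKψ : ∀ k : E, (k : B) ∈ K → ∃ y, ψ y = k := by
    rintro ⟨k, hkE⟩ ⟨x, hx, rfl⟩
    obtain ⟨c, hc, _, ⟨k, hk, rfl⟩, rfl⟩ := Submodule.mem_sup.1 (hX hx)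
    exact ⟨(⟨c, hc⟩, ⟨k, hKE hk⟩), Subtype.ext (hψK _ _ hk)⟩
  obtain ⟨q₁, hq₁⟩ := exists_extension_of_injective hCinj ψ hψinj (LinearMap.fst R C E)
  obtain ⟨q₂, hq₂⟩ := exists_extension_of_injective hEinj ψ hψinj (LinearMap.snd R C E)
  let q : E →ₗ[R] C × E := q₁.prod q₂
  have hq : ∀ y, q (ψ y) = y := fun y => Prod.ext (hq₁ y) (hq₂ y)
  -- The range of `ψ` contains `K`, on which the left inverse `q` is injective; essentiality spreads
  -- this to `E`. Injectivity of `q` then makes `ψ` surjective.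
  have hqinj : Function.Injective q := by
    rw [injective_iff_map_eq_zero]
    intro x hx
    by_contra hx0
    obtain ⟨s, hs, hs0⟩ := hess x x.2 (fun h => hx0 (Subtype.ext h))
    obtain ⟨y, hy⟩ := hKψ (s • x) hs
    have hy0 : y = 0 := by rw [← hq y, hy, map_smul, hx, smul_zero]
    rw [hy0, map_zero] at hy
    exact hs0 (congrArg Subtype.val hy).symm
  have hψsurj : Function.Surjective ψ := fun x => ⟨q x, hqinj (hq _)⟩
  let eψ : (C × E) ≃ₗ[R] E := LinearEquiv.ofBijective ψ ⟨hψinj, hψsurj⟩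
  let eB := equivKerProd E.subtype r hr
  exact ⟨e.symm ≪≫ₗ (LinearEquiv.refl R C).prodCongr (eB.symm ≪≫ₗ LinearEquiv.prodComm R _ _) ≪≫ₗ
    (LinearEquiv.prodAssoc R C E (LinearMap.ker r)).symm ≪≫ₗ
    eψ.prodCongr (LinearEquiv.refl R _) ≪≫ₗ LinearEquiv.prodComm R _ _ ≪≫ₗ eB⟩

/-! ### Chains witnessing limit models -/

/-- An increasing continuous chain of submodules witnessing that `M` is a limit model. -/
structure IsLimitChain {M : Type u} [AddCommGroup M] [Module R M] (lam : Cardinal.{u})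
    (a : Ordinal.{u}) (c : Ordinal.{u} → Submodule R M) : Prop where
  aleph0_le : ℵ₀ ≤ lam
  isSuccLimit : IsSuccLimit a
  card_le : a.card ≤ lam
  mk_eq : ∀ i < a, #(c i) = lam
  mono : ∀ i j, i ≤ j → j < a → c i ≤ c j
  continuous : ∀ i < a, IsSuccLimit i → ∀ x, x ∈ c i ↔ ∃ j < i, x ∈ c j
  exhaustive : ∀ x, ∃ i < a, x ∈ c i
  universal : ∀ i < a, ∃ h : c i ≤ c (succ i), IsUniversalOver (Submodule.inclusion h)

theorem isLimitModel_iff {M : Type u} [AddCommGroup M] [Module R M] {lam : Cardinal.{u}}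
    {a : Ordinal.{u}} : IsLimitModel R lam a M ↔
      ∃ c : Ordinal.{u} → Submodule R M, IsLimitChain lam a c := by
  constructor
  · rintro ⟨N, h1, h2, h3, c, h4, h5, h6, -, h7, h8⟩
    refine ⟨c, h1, h2, Cardinal.card_le_iff.2 h3, h4, h5, fun i hi hl x => ?_, fun x => ?_, h8⟩
    · rw [← SetLike.mem_coe, h6 i hi hl]
      simp
    · have := h7.subset (Set.mem_univ x)
      simpa using this
  · rintro ⟨c, h1, h2, h3, h4, h5, h6, h7, h8⟩
    refine ⟨c 0, h1, h2, Cardinal.card_le_iff.1 h3, c, h4, h5, fun i hi hl => ?_, rfl, ?_, h8⟩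
    · ext x
      simpa using h6 i hi hl x
    · ext x
      simpa using h7 x

namespace IsLimitChain

variable {M : Type u} [AddCommGroup M] [Module R M] {lam : Cardinal.{u}}
  {a : Ordinal.{u}} {c : Ordinal.{u} → Submodule R M} (hc : IsLimitChain lam a c)

include hc

theorem mk_le : #M ≤ lam := by
  rw [← mk_univ, show (Set.univ : Set M) = ⋃ i < a, (c i : Set M) by
    ext x; simpa using hc.exhaustive x]
  exact mk_biUnion_le_of_le hc.card_le hc.aleph0_le _ fun i hi => (hc.mk_eq i hi).le

theorem succ_lt {i : Ordinal.{u}} (hi : i < a) : succ i < a := hc.isSuccLimit.succ_lt hi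

/-- Since `e` may have a kernel, this extends arbitrary homomorphisms from left ideals. The last
clause, that `g` meets `c i` only where forced, yields injectivity in the back-and-forth and new
values in the non-injectivity argument. -/
theorem amalgamate {i : Ordinal.{u}} (hi : i < a) {B C : Type u} [AddCommGroup B] [Module R B]
    [AddCommGroup C] [Module R C] (hC : #C ≤ lam) (k : B →ₗ[R] C) (hk : Function.Injective k)
    (e : B →ₗ[R] M) (he : ∀ b, e b ∈ c i) :
    ∃ g : C →ₗ[R] M, (∀ x, g x ∈ c (succ i)) ∧ (∀ b, g (k b) = e b) ∧
      ∀ x, g x ∈ c i → ∃ b, k b = x ∧ e b = g x := by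
  obtain ⟨h, hu⟩ := hc.universal i hi
  have hN : #(c i) = lam := hc.mk_eq i hi
  obtain ⟨g, hg, hg'⟩ := hu.amalgamate (by rw [hN]; exact hc.aleph0_le) (by rwa [hN]) k hk
    (e.codRestrict (c i) he)
  refine ⟨(c (succ i)).subtype ∘ₗ g, fun x => (g x).2, fun b => congrArg Subtype.val (hg b),
    fun x hx => ?_⟩
  obtain ⟨b, hb, hb'⟩ := hg' x ⟨_, hx⟩ (Subtype.ext rfl)
  exact ⟨b, hb, congrArg Subtype.val hb'⟩

theorem exists_embedding_succ {i : Ordinal.{u}} (hi : i < a) {C : Type u} [AddCommGroup C]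
    [Module R C] (hC : #C ≤ lam) :
    ∃ g : C →ₗ[R] M, Function.Injective g ∧ ∀ x, g x ∈ c (succ i) := by
  obtain ⟨h, hu⟩ := hc.universal i hi
  have hN : #(c i) = lam := hc.mk_eq i hi
  obtain ⟨g, hg⟩ := hu.exists_embedding (C := C) (by rw [hN]; exact hc.aleph0_le) (by rwa [hN])
  exact ⟨(c (succ i)).subtype ∘ₗ g, (c (succ i)).injective_subtype.comp hg, fun x => (g x).2⟩

theorem exists_embedding {C : Type u} [AddCommGroup C] [Module R C] (hC : #C ≤ lam) :
    ∃ g : C →ₗ[R] M, Function.Injective g := by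
  obtain ⟨g, hg, -⟩ := hc.exists_embedding_succ (isSuccLimit_pos hc.isSuccLimit) hC
  exact ⟨g, hg⟩

end IsLimitChain

/-! ### Injectivity and the length of the chain -/

/-- A Baer-type criterion: a union of a chain of regular length at least `gamma R`
in which homomorphisms from left ideals into earlier stages extend is injective. -/
theorem injective_of_chain {κ : Cardinal.{u}} (hκ : κ.IsRegular) (hγ : gamma R ≤ κ)
    {A : Type u} [AddCommGroup A] [Module R A] (E : Submodule R A)
    (x : Ordinal.{u} → Submodule R A) (hmono : ∀ i j, i ≤ j → j < κ.ord → x i ≤ x j)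
    (hE : ∀ y ∈ E, ∃ i < κ.ord, y ∈ x i)
    (hext : ∀ i < κ.ord, ∀ (I : Ideal R) (f : I →ₗ[R] A), (∀ r, f r ∈ x i) →
      ∃ m ∈ E, ∀ r : I, f r = (r : R) • m) : Module.Injective R E := by
  refine Module.Baer.injective fun I f => ?_
  obtain ⟨s, hs, rfl⟩ := (gamma_spec R).2 I
  have hss : s ⊆ Ideal.span s := Ideal.subset_span
  choose o ho ho' using fun r : s => hE (f ⟨r, hss r.2⟩) (f _).2
  -- Fewer than `κ` generators and regularity of `κ` put all their images into one stage.
  have hsup : iSup o < κ.ord :=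
    Ordinal.iSup_lt_of_lt_cof (by rw [hκ.cof_ord]; exact hs.trans_le hγ) ho
  have hf : ∀ r, (E.subtype ∘ₗ f) r ∈ x (iSup o) := by
    rintro ⟨r, hr⟩
    have : Ideal.span s ≤ ((x (iSup o)).comap (E.subtype ∘ₗ f)).map (Ideal.span s).subtype := by
      refine Ideal.span_le.2 fun y hy => ⟨⟨y, hss hy⟩, ?_, rfl⟩
      exact hmono _ _ (Ordinal.le_iSup o ⟨y, hy⟩) hsup (ho' ⟨y, hy⟩)
    obtain ⟨z, hz, rfl⟩ := this hr
    exact hz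
  obtain ⟨m, hm, hfm⟩ := hext _ hsup _ _ hf
  exact ⟨LinearMap.toSpanSingleton R E ⟨m, hm⟩, fun r hr => Subtype.ext (hfm ⟨r, hr⟩).symm⟩

/-- Limit models of long cofinality are injective modules. -/
theorem IsLimitChain.injective {M : Type u} [AddCommGroup M] [Module R M] {lam κ : Cardinal.{u}}
    {c : Ordinal.{u} → Submodule R M} (hc : IsLimitChain lam κ.ord c) (hR : #R ≤ lam)
    (hκ : κ.IsRegular) (hγ : gamma R ≤ κ) : Module.Injective R M := by
  have : Module.Injective R (⊤ : Submodule R M) := by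
    refine injective_of_chain hκ hγ ⊤ c hc.mono (fun y _ => hc.exhaustive y) ?_
    intro i hi I f hf
    obtain ⟨g, -, hg, -⟩ := hc.amalgamate hi hR I.subtype I.injective_subtype f hf
    refine ⟨g 1, trivial, fun r => ?_⟩
    rw [← map_smul, smul_eq_mul, mul_one, ← hg r]
    rfl
  exact injective_of_retract this Submodule.topEquiv.symm.toLinearMap
    Submodule.topEquiv.toLinearMap fun b => Submodule.topEquiv.apply_symm_apply b

/-- Limit models of regular length below `gamma R` are not injective. -/
theorem IsLimitChain.gamma_le_of_injective {M : Type u} [AddCommGroup M] [Module R M]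
    {lam κ : Cardinal.{u}} {c : Ordinal.{u} → Submodule R M} (hc : IsLimitChain lam κ.ord c)
    (hR : #R ≤ lam) (hκ : κ.IsRegular) (hM : Module.Injective R M) : gamma R ≤ κ := by
  by_contra! hlt
  have hnot : ¬ ∀ I : Ideal R, IsLTGenerated κ I := fun h =>
    notMem_of_lt_csInf' hlt ⟨hκ.aleph0_le, h⟩
  push Not at hnot
  obtain ⟨I, hI⟩ := hnot
  -- `G i` is the graph of a homomorphism into `c i` from a subideal of `I` with at most `i.card`
  -- generators. For `i < κ.ord` that subideal is not `I`, so a new generator can be sent outside `c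
  -- i`. The bound by `c i` is dropped at `κ.ord`, where `c` carries no information.
  refine (exists_transfinite_chain (L := Submodule R (R × M)) κ.ord
    (fun i G => (∀ p ∈ G, p.1 = 0 → p.2 = 0) ∧
      (∃ s : Set R, #s ≤ i.card ∧ G.map (LinearMap.fst R R M) = Ideal.span s) ∧
      G.map (LinearMap.fst R R M) ≤ I ∧ (i < κ.ord → ∀ p ∈ G, p.2 ∈ c i))
    (fun i _ G' => ∃ p ∈ G', p.2 ∉ c i) ⊥ ?_ ?_ ?_).elim ?_
  rotate_right
  · rintro G ⟨hmono, -, hP, hQ, -⟩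
    obtain ⟨hfun, -⟩ := hP _ le_rfl
    let T := G κ.ord
    have hk : Function.Injective (LinearMap.fst R R M ∘ₗ T.subtype) := by
      rw [injective_iff_map_eq_zero]
      rintro ⟨p, hp⟩ h0
      exact Subtype.ext (Prod.ext h0 (hfun p hp h0))
    obtain ⟨g, hg⟩ := exists_extension_of_injective hM _ hk (LinearMap.snd R R M ∘ₗ T.subtype)
    -- An extension to `R` has the form `r ↦ r • g 1`, so all its values stay in any stage
    -- containing `g 1`.
    obtain ⟨i, hi, hgi⟩ := hc.exhaustive (g 1)
    obtain ⟨p, hp, hp'⟩ := hQ i hi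
    apply hp'
    have hpg : g p.1 = p.2 := hg ⟨p, hmono (succ_le_of_lt hi) hp⟩
    rw [← hpg, ← mul_one p.1, ← smul_eq_mul, map_smul]
    exact (c i).smul_mem _ hgi
  · refine ⟨fun p hp _ => ?_, ⟨∅, by simp, by simp⟩, by simp, fun _ p hp => ?_⟩
    · rw [(Submodule.mem_bot R).1 hp]; rfl
    · rw [(Submodule.mem_bot R).1 hp]; exact (c 0).zero_mem
  · rintro i hi G ⟨hfun, ⟨s, hs, hGs⟩, hGI, hGc⟩
    have hsI : Ideal.span s ≤ I := hGs ▸ hGI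
    obtain ⟨y, hyI, hys⟩ : ∃ y ∈ I, y ∉ Ideal.span s := by
      by_contra! h
      exact hI ⟨s, hs.trans_lt (lt_ord.1 hi), le_antisymm hsI h⟩
    have hk : Function.Injective (LinearMap.fst R R M ∘ₗ G.subtype) := by
      rw [injective_iff_map_eq_zero]
      rintro ⟨p, hp⟩ h0
      exact Subtype.ext (Prod.ext h0 (hfun p hp h0))
    obtain ⟨g, hgc, hg, hg'⟩ := hc.amalgamate hi hR _ hk (LinearMap.snd R R M ∘ₗ G.subtype)
      fun b => hGc hi b b.2
    let J : Submodule R R := Ideal.span (insert y s)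
    have hfst : (J.map (LinearMap.id.prod g)).map (LinearMap.fst R R M) = J := by
      rw [← Submodule.map_comp, LinearMap.fst_prod, Submodule.map_id]
    refine ⟨J.map (LinearMap.id.prod g), fun p hp => ?_,
      ⟨?_, ⟨insert y s, ?_, hfst⟩, ?_, ?_⟩, ?_⟩
    · refine ⟨p.1, ?_, Prod.ext rfl (hg ⟨p, hp⟩)⟩
      exact Ideal.span_mono (Set.subset_insert y s) (hGs ▸ ⟨p, hp, rfl⟩)
    · rintro _ ⟨r, -, rfl⟩ (h : r = 0)
      change g r = 0
      rw [h, map_zero]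
    · rw [Order.succ_eq_add_one, Ordinal.card_add, Ordinal.card_one]
      exact mk_insert_le.trans (by gcongr)
    · rw [hfst]
      exact Ideal.span_le.2 (Set.insert_subset hyI (Ideal.span_le.1 hsI))
    · rintro - _ ⟨r, -, rfl⟩
      exact hgc r
    · refine ⟨_, ⟨y, Ideal.subset_span (Set.mem_insert y s), rfl⟩, fun h => hys ?_⟩
      obtain ⟨b, hb, -⟩ := hg' y h
      rw [← hGs]
      exact ⟨b, b.2, hb⟩
  · intro i hi hl x hx hP
    have hi0 := isSuccLimit_pos hl
    have hmem := fun p => mem_biSup_of_monotone hx hi0 (y := p)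
    choose! s hs hs' using fun j hj => (hP j hj).2.1
    refine ⟨fun p hp h0 => ?_, ⟨⋃ j < i, s j, ?_, ?_⟩, ?_, fun hi' p hp => ?_⟩
    · obtain ⟨j, hj, hp⟩ := (hmem p).1 hp
      exact (hP j hj).1 p hp h0
    · refine mk_biUnion_le_of_le le_rfl ?_ _ fun j hj =>
        (hs j hj).trans (Ordinal.card_le_card hj.le)
      rw [Ordinal.aleph0_le_card]
      exact Ordinal.omega0_le_of_isSuccLimit hl
    · simp only [Submodule.map_iSup, Ideal.span, Submodule.span_iUnion]
      exact iSup_congr fun j => iSup_congr fun hj => hs' j hj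
    · simp only [Submodule.map_iSup]
      exact iSup₂_le fun j hj => (hP j hj).2.2.1
    · obtain ⟨j, hj, hp⟩ := (hmem p).1 hp
      exact hc.mono j i hj.le hi' ((hP j hj).2.2.2 (hj.trans hi') p hp)

/-! ### Uniqueness by back-and-forth -/

/-- A submodule of `M × N` that is the graph of a bijection is an isomorphism. -/
theorem nonempty_equiv_of_graph {M N : Type u} [AddCommGroup M] [Module R M] [AddCommGroup N]
    [Module R N] (G : Submodule R (M × N)) (h : ∀ p ∈ G, p.1 = 0 ↔ p.2 = 0)
    (h₁ : ∀ x, ∃ p ∈ G, p.1 = x) (h₂ : ∀ y, ∃ p ∈ G, p.2 = y) : Nonempty (M ≃ₗ[R] N) := by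
  have b₁ : Function.Bijective (LinearMap.fst R M N ∘ₗ G.subtype) := by
    constructor
    · rw [injective_iff_map_eq_zero]
      rintro ⟨p, hp⟩ (h0 : p.1 = 0)
      exact Subtype.ext (Prod.ext h0 ((h p hp).1 h0))
    · intro x
      obtain ⟨p, hp, rfl⟩ := h₁ x
      exact ⟨⟨p, hp⟩, rfl⟩
  have b₂ : Function.Bijective (LinearMap.snd R M N ∘ₗ G.subtype) := by
    constructor
    · rw [injective_iff_map_eq_zero]
      rintro ⟨p, hp⟩ (h0 : p.2 = 0)
      exact Subtype.ext (Prod.ext ((h p hp).2 h0) h0)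
    · intro x
      obtain ⟨p, hp, rfl⟩ := h₂ x
      exact ⟨⟨p, hp⟩, rfl⟩
  exact ⟨(LinearEquiv.ofBijective _ b₁).symm ≪≫ₗ LinearEquiv.ofBijective _ b₂⟩

/-- Limit models of the same length are isomorphic. -/
theorem IsLimitChain.nonempty_equiv {M N : Type u} [AddCommGroup M] [Module R M]
    [AddCommGroup N] [Module R N] {lam : Cardinal.{u}} {a : Ordinal.{u}}
    {c : Ordinal.{u} → Submodule R M} {d : Ordinal.{u} → Submodule R N}
    (hc : IsLimitChain lam a c) (hd : IsLimitChain lam a d) : Nonempty (M ≃ₗ[R] N) := by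
  obtain ⟨g, hg, hgd⟩ := hd.exists_embedding_succ (isSuccLimit_pos hd.isSuccLimit)
    (hc.mk_eq 0 (isSuccLimit_pos hc.isSuccLimit)).le
  -- For `i < a`, `G i` is the graph of an embedding of `c i` into `d (succ i)`; the shift leaves
  -- room for the forth move. The clause over `j < i` records that both chains are exhausted.
  refine (exists_transfinite_chain (L := Submodule R (M × N)) a
    (fun i G => (∀ p ∈ G, p.1 = 0 ↔ p.2 = 0) ∧
      (∀ j < i, (∀ x ∈ c j, ∃ p ∈ G, p.1 = x) ∧ ∀ y ∈ d j, ∃ p ∈ G, p.2 = y) ∧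
      (i < a → (∀ x ∈ c i, ∃ p ∈ G, p.1 = x) ∧ ∀ p ∈ G, p.1 ∈ c i ∧ p.2 ∈ d (succ i)))
    (fun _ _ _ => True)
    (LinearMap.range ((c 0).subtype.prod g)) ?_ ?_ ?_).elim ?_
  rotate_right
  · rintro G ⟨-, -, hP, -, -⟩
    obtain ⟨h1, h2, -⟩ := hP a le_rfl
    refine nonempty_equiv_of_graph (G a) h1 (fun x => ?_) fun y => ?_
    · obtain ⟨i, hi, hx⟩ := hc.exhaustive x
      exact (h2 i hi).1 x hx
    · obtain ⟨i, hi, hy⟩ := hd.exhaustive y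
      exact (h2 i hi).2 y hy
  · refine ⟨?_, fun j hj => absurd hj not_lt_bot, fun _ => ⟨fun x hx => ?_, ?_⟩⟩
    · rintro _ ⟨x, rfl⟩
      change (x : M) = 0 ↔ g x = 0
      rw [map_eq_zero_iff g hg, Submodule.coe_eq_zero]
    · exact ⟨_, ⟨⟨x, hx⟩, rfl⟩, rfl⟩
    · rintro _ ⟨x, rfl⟩
      exact ⟨x.2, hgd x⟩
  · rintro i hi G ⟨hG, -, hGi⟩
    obtain ⟨-, hGcd⟩ := hGi hi
    have hsi := hc.succ_lt hi
    have hssi := hc.succ_lt hsi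
    let k : G →ₗ[R] d (succ i) := (LinearMap.snd R M N ∘ₗ G.subtype).codRestrict (d (succ i))
      fun b => (hGcd b b.2).2
    have hk : Function.Injective k := by
      rw [injective_iff_map_eq_zero]
      rintro ⟨p, hp⟩ h0
      have h0 : p.2 = 0 := congrArg Subtype.val h0
      exact Subtype.ext (Prod.ext ((hG p hp).2 h0) h0)
    -- Back: the inverse of the partial isomorphism extends to all of `d (succ i)`.
    obtain ⟨g, hgc, hg, hg'⟩ := hc.amalgamate hi (hd.mk_eq _ hsi).le k hk
      (LinearMap.fst R M N ∘ₗ G.subtype) fun b => (hGcd b b.2).1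
    have hginj : Function.Injective (g.codRestrict (c (succ i)) hgc) := by
      rw [injective_iff_map_eq_zero]
      intro x hx
      have hx : g x = 0 := congrArg Subtype.val hx
      obtain ⟨b, rfl, hb⟩ := hg' x (hx ▸ (c i).zero_mem)
      exact Subtype.ext ((hG b b.2).1 (hb.trans hx))
    -- Forth: the inverse of `g` on its image extends to all of `c (succ i)`.
    obtain ⟨f, hfd, hf, hf'⟩ := hd.amalgamate hsi (hc.mk_eq _ hsi).le _ hginj
      (d (succ i)).subtype fun b => b.2
    have hfinj : ∀ x, f x = 0 → x = 0 := by
      intro x hx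
      obtain ⟨b, rfl, hb⟩ := hf' x (hx ▸ (d (succ i)).zero_mem)
      have hb : b = 0 := Subtype.ext (hb.trans hx)
      rw [hb, map_zero]
    have hdmem : ∀ y ∈ d (succ i), ∃ p ∈ LinearMap.range ((c (succ i)).subtype.prod f), p.2 = y :=
      fun y hy => ⟨_, ⟨_, rfl⟩, hf ⟨y, hy⟩⟩
    have hcmem : ∀ x ∈ c (succ i), ∃ p ∈ LinearMap.range ((c (succ i)).subtype.prod f), p.1 = x :=
      fun x hx => ⟨_, ⟨⟨x, hx⟩, rfl⟩, rfl⟩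
    refine ⟨LinearMap.range ((c (succ i)).subtype.prod f), fun p hp => ?_,
      ⟨?_, fun j hj => ⟨fun x hx => ?_, fun y hy => ?_⟩, fun _ => ⟨hcmem, ?_⟩⟩, trivial⟩
    · refine ⟨_, Prod.ext ?_ (hf (k ⟨p, hp⟩))⟩
      exact hg ⟨p, hp⟩
    · rintro _ ⟨x, rfl⟩
      change (x : M) = 0 ↔ f x = 0
      exact ⟨fun h => by rw [show x = 0 from Subtype.ext h, map_zero], fun h => by
        rw [hfinj x h]; rfl⟩
    · exact hcmem x (hc.mono j _ hj.le hsi hx)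
    · exact hdmem y (hd.mono j _ hj.le hsi hy)
    · rintro _ ⟨x, rfl⟩
      exact ⟨x.2, hfd x⟩
  · intro i hi hl x hx hP
    have hmem := fun p => mem_biSup_of_monotone hx (isSuccLimit_pos hl) (y := p)
    refine ⟨fun p hp => ?_, fun j hj => ⟨fun y hy => ?_, fun y hy => ?_⟩,
      fun hi' => ⟨fun y hy => ?_, fun p hp => ?_⟩⟩
    · obtain ⟨j, hj, hp⟩ := (hmem p).1 hp
      exact (hP j hj).1 p hp
    · have hj' := hl.succ_lt hj
      obtain ⟨p, hp, hpy⟩ := ((hP _ hj').2.1 j (lt_succ j)).1 y hy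
      exact ⟨p, (hmem p).2 ⟨_, hj', hp⟩, hpy⟩
    · have hj' := hl.succ_lt hj
      obtain ⟨p, hp, hpy⟩ := ((hP _ hj').2.1 j (lt_succ j)).2 y hy
      exact ⟨p, (hmem p).2 ⟨_, hj', hp⟩, hpy⟩
    · obtain ⟨j, hj, hy⟩ := (hc.continuous i hi' hl y).1 hy
      obtain ⟨p, hp, hpy⟩ := ((hP j hj).2.2 (hj.trans hi')).1 y hy
      exact ⟨p, (hmem p).2 ⟨_, hj, hp⟩, hpy⟩
    · obtain ⟨j, hj, hp⟩ := (hmem p).1 hp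
      obtain ⟨h1, h2⟩ := ((hP j hj).2.2 (hj.trans hi')).2 p hp
      exact ⟨hc.mono j i hj.le hi' h1,
        hd.mono _ _ (succ_le_succ hj.le) (hd.succ_lt hi') h2⟩

/-! ### Existence of limit models -/

/-- Every module embeds in an injective module. -/
theorem exists_injective_embedding (R : Type u) [Ring R] (M : Type u) [AddCommGroup M]
    [Module R M] : ∃ (A : ModuleCat.{u} R) (f : M →ₗ[R] A), Function.Injective f ∧
      Module.Injective R A := by
  obtain ⟨⟨I, hI, f, hf⟩⟩ := CategoryTheory.EnoughInjectives.presentation (ModuleCat.of R M)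
  exact ⟨I, f.hom, (ModuleCat.mono_iff_injective f).1 hf,
    Module.injective_module_of_injective_object R I⟩

/-- In an injective module, small submodules lie in small injective submodules. -/
theorem exists_small_injective_submodule {A : Type u} [AddCommGroup A] [Module R A]
    (hA : Module.Injective R A) {lam : Cardinal.{u}} (hlam : lam.IsRegular) (hR : #R ≤ lam)
    (hγ : gamma R ≤ lam) (hfew : ∀ N : Submodule R A, #N ≤ lam → #(R →ₗ.[R] N) ≤ lam)
    (N : Submodule R A) (hN : #N ≤ lam) :
    ∃ E : Submodule R A, N ≤ E ∧ #E ≤ lam ∧ Module.Injective R E := by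
  obtain ⟨x, hmono, hx0, hP, hQ, hx⟩ := exists_transfinite_chain (L := Submodule R A) lam.ord
    (fun _ X => #X ≤ lam) (fun _ X Y => ∀ (I : Ideal R) (f : I →ₗ[R] A), (∀ r, f r ∈ X) →
      ∃ m ∈ Y, ∀ r : I, f r = (r : R) • m) N hN (by
    intro i hi X hX
    have hext : ∀ f : R →ₗ.[R] X, ∃ m : A, ∀ r : f.domain, (f r : A) = (r : R) • m := by
      intro f
      obtain ⟨g, hg⟩ := exists_extension_of_injective hA f.domain.subtype
        f.domain.injective_subtype (X.subtype ∘ₗ f.toFun)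
      refine ⟨g 1, fun r => ?_⟩
      rw [← map_smul, smul_eq_mul, mul_one]
      exact (hg r).symm
    -- One solution in `A` is adjoined for each partial homomorphism; `hfew` keeps the result of
    -- size at most `lam`.
    choose m hm using hext
    refine ⟨Submodule.span R (X ∪ Set.range m), fun y hy => Submodule.subset_span (Or.inl hy),
      mk_span_le hlam.aleph0_le hR ?_, fun I f hf => ?_⟩
    · refine (mk_union_le _ _).trans ((add_le_add hX (mk_range_le.trans (hfew X hX))).trans ?_)
      exact (add_eq_self hlam.aleph0_le).le
    · refine ⟨m ⟨I, f.codRestrict X hf⟩, Submodule.subset_span (Or.inr ⟨_, rfl⟩), fun r => ?_⟩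
      exact hm ⟨I, f.codRestrict X hf⟩ r) (by
    intro i hi hl x hx hP
    refine mk_biSup_le hx (isSuccLimit_pos hl) hlam.aleph0_le ?_ hP
    exact (Ordinal.card_le_card hi).trans (card_ord lam).le)
  have hl : IsSuccLimit lam.ord := isSuccLimit_ord hlam.aleph0_le
  refine ⟨x lam.ord, hx0 ▸ hmono zero_le, hP _ le_rfl,
    injective_of_chain hlam hγ _ x (fun i j hij _ => hmono hij) (fun y hy => ?_) ?_⟩
  · rw [hx _ le_rfl hl] at hy
    exact (mem_biSup_of_monotone hmono (isSuccLimit_pos hl)).1 hy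
  · intro i hi I f hf
    obtain ⟨m, hm, hfm⟩ := hQ i hi I f hf
    exact ⟨m, hmono (succ_le_of_lt hi) hm, hfm⟩

/-- A submodule that is small avoids one of many independent submodules. -/
theorem exists_disjoint_single {A U ι : Type u} [AddCommGroup A] [Module R A] [AddCommGroup U]
    [Module R U] (j : (ι →₀ U) →ₗ[R] A) (hj : Function.Injective j) (E : Submodule R A)
    (hE : #E < #ι) : ∃ i : ι, ∀ v : U, j (Finsupp.single i v) ∈ E → v = 0 := by
  by_contra! h
  choose v hv hv0 using h
  refine hE.not_ge (mk_le_of_injective (f := fun i => (⟨_, hv i⟩ : E)) fun i i' hii => ?_)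
  have := hj (congrArg Subtype.val hii)
  rcases (Finsupp.single_eq_single_iff _ _ _ _).1 this with h | h
  · exact h.1
  · exact absurd h.1 (hv0 i)

/-- The sum of an injective extension of `N` with an independent module that contains every
small module is universal over `N`. -/
theorem isUniversalOver_sup {A U : Type u} [AddCommGroup A] [Module R A] [AddCommGroup U]
    [Module R U] {lam : Cardinal.{u}} (hlam : ℵ₀ ≤ lam) {N E : Submodule R A} (hNE : N ≤ E)
    (hN : #N = lam) (hE : #E ≤ lam) (hEinj : Module.Injective R E) (hU : #U ≤ lam)
    (huniv : ∀ (C : Type u) [AddCommGroup C] [Module R C], #C ≤ lam →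
      ∃ g : C →ₗ[R] U, Function.Injective g)
    (j : U →ₗ[R] A) (hj : ∀ v, j v ∈ E → v = 0) :
    IsUniversalOver (Submodule.inclusion (hNE.trans (le_sup_left : E ≤ E ⊔ LinearMap.range j))) :=
    by
  have hcard : #(E ⊔ LinearMap.range j : Submodule R A) = lam := by
    apply le_antisymm
    · have hsurj : Function.Surjective (fun p : E × U => (⟨p.1 + j p.2, Submodule.add_mem_sup p.1.2
          ⟨_, rfl⟩⟩ : (E ⊔ LinearMap.range j : Submodule R A))) := by
        rintro ⟨y, hy⟩
        obtain ⟨e, he, _, ⟨v, rfl⟩, rfl⟩ := Submodule.mem_sup.1 hy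
        exact ⟨(⟨e, he⟩, v), rfl⟩
      refine (mk_le_of_surjective hsurj).trans ?_
      rw [mk_prod, lift_id, lift_id]
      exact (mul_le_mul' hE hU).trans (mul_eq_self hlam).le
    · rw [← hN]
      exact mk_le_of_injective (Submodule.inclusion_injective (hNE.trans le_sup_left))
  refine ⟨hcard.trans hN.symm, Submodule.inclusion_injective _, fun P _ _ hP i hi => ?_⟩
  -- The embedding is `f + j ∘ q`, with `q` factoring through `P ⧸ N`. Independence of `j` from `E`
  -- confines its kernel to `N`, where `f` is the inclusion.
  obtain ⟨f, hf⟩ := exists_extension_of_injective hEinj i hi (Submodule.inclusion hNE)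
  obtain ⟨g, hg⟩ := huniv (P ⧸ LinearMap.range i) (by
    refine (mk_le_of_surjective (LinearMap.range i).mkQ_surjective).trans ?_
    rw [hP]
    exact hcard.le)
  let q : P →ₗ[R] U := g ∘ₗ (LinearMap.range i).mkQ
  refine ⟨(E.subtype ∘ₗ f + j ∘ₗ q).codRestrict _ fun p =>
    Submodule.add_mem_sup (f p).2 ⟨q p, rfl⟩, ?_, ?_⟩
  · rw [injective_iff_map_eq_zero]
    intro p hp
    have hp : (f p : A) + j (q p) = 0 := congrArg Subtype.val hp
    have hq : q p = 0 := hj _ (by rw [eq_neg_of_add_eq_zero_right hp]; exact E.neg_mem (f p).2)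
    obtain ⟨n, rfl⟩ := (Submodule.Quotient.mk_eq_zero (LinearMap.range i)).1
      (hg (hq.trans (map_zero g).symm))
    rw [hq, map_zero, add_zero, hf, Submodule.coe_inclusion, Submodule.coe_eq_zero] at hp
    rw [hp, map_zero]
  · ext n
    have hq : q (i n) = 0 := by
      change g _ = 0
      rw [show (LinearMap.range i).mkQ (i n) = 0 from
        (Submodule.Quotient.mk_eq_zero _).2 ⟨n, rfl⟩, map_zero]
    change (f (i n) : A) + j (q (i n)) = n
    rw [hq, map_zero, add_zero, hf]
    rfl

/-- Universality of an inclusion of submodules is inherited by their preimages. -/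
theorem IsUniversalOver.comap_subtype {A : Type u} [AddCommGroup A] [Module R A]
    {X Y M : Submodule R A} (hXY : X ≤ Y) (hYM : Y ≤ M)
    (h : IsUniversalOver (Submodule.inclusion hXY)) :
    IsUniversalOver (Submodule.inclusion (Submodule.comap_mono (f := M.subtype) hXY)) := by
  let eX := Submodule.comapSubtypeEquivOfLe (hXY.trans hYM)
  let eY := Submodule.comapSubtypeEquivOfLe hYM
  refine ⟨?_, Submodule.inclusion_injective _, fun P _ _ hP i hi => ?_⟩
  · rw [mk_congr eX.toEquiv, mk_congr eY.toEquiv, h.1]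
  · obtain ⟨f, hf, hfi⟩ := h.2.2 P (hP.trans (mk_congr eY.toEquiv)) (i ∘ₗ eX.symm.toLinearMap)
      (hi.comp eX.symm.injective)
    refine ⟨eY.symm.toLinearMap ∘ₗ f, eY.symm.injective.comp hf, LinearMap.ext fun n => ?_⟩
    have := LinearMap.congr_fun hfi (eX n)
    simp only [LinearMap.comp_apply, LinearEquiv.coe_coe, LinearEquiv.symm_apply_apply] at this
    simp only [LinearMap.comp_apply, LinearEquiv.coe_coe, this]
    rfl

/-- If there is a limit model then there are limit models of every length. -/
theorem exists_isLimitChain {lam : Cardinal.{u}} (hlam : lam.IsRegular) (hR : #R ≤ lam)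
    (hγ : gamma R ≤ lam) (hstable : IsStableIn R lam) {a : Ordinal.{u}} (ha : IsSuccLimit a)
    (hal : a.card ≤ lam) : ∃ (M : ModuleCat.{u} R) (c : Ordinal.{u} → Submodule R M),
      IsLimitChain lam a c := by
  obtain ⟨V, b, hV⟩ := hstable
  obtain ⟨d, hd⟩ := isLimitModel_iff.1 hV
  have hl := hlam.aleph0_le
  have hb0 : 0 < b := isSuccLimit_pos hd.isSuccLimit
  have hb1 := hd.succ_lt hb0
  let U := d (succ 0)
  have hU : #U = lam := hd.mk_eq _ hb1
  have huniv : ∀ (C : Type u) [AddCommGroup C] [Module R C], #C ≤ lam →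
      ∃ g : C →ₗ[R] U, Function.Injective g := by
    intro C _ _ hC
    obtain ⟨g, hg, hgd⟩ := hd.exists_embedding_succ hb0 hC
    exact ⟨g.codRestrict U hgd, fun x y hxy => hg (congrArg Subtype.val hxy)⟩
  have hfew : ∀ (C : Type u) [AddCommGroup C] [Module R C], #C ≤ lam → #(R →ₗ.[R] C) ≤ lam := by
    intro C _ _ hC
    obtain ⟨g, hg⟩ := huniv C hC
    obtain ⟨h, hu⟩ := hd.universal _ hb1
    rw [← hU]
    exact mk_linearPMap_le hu (by rw [hU]; exact hl) (by rwa [hU]) g hg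
  -- With `succ lam` independent copies of `U` in the injective module `A`, every submodule of size
  -- at most `lam` misses one of them, so the chain can be built inside `A`.
  obtain ⟨ι, hι⟩ : ∃ ι : Type u, #ι = succ lam := ⟨_, mk_out _⟩
  obtain ⟨A, j, hj, hA⟩ := exists_injective_embedding R (ι →₀ U)
  have hne : Nonempty ι := mk_ne_zero_iff.1 (by rw [hι]; exact (succ_pos lam).ne')
  obtain ⟨i₀⟩ := hne
  refine (exists_transfinite_chain (L := Submodule R A) a (fun _ X => #X = lam)
    (fun _ X Y => ∃ h : X ≤ Y, IsUniversalOver (Submodule.inclusion h))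
    (LinearMap.range (j ∘ₗ Finsupp.lsingle i₀)) ?_ ?_ ?_).elim ?_
  rotate_right
  · rintro x ⟨hmono, -, hP, hQ, hx⟩
    have hle : ∀ i < a, x i ≤ x a := fun i hi => hmono hi.le
    refine ⟨ModuleCat.of R (x a), fun i => (x i).comap (x a).subtype, hl, ha, hal,
      fun i hi => ?_, fun i k hik _ => Submodule.comap_mono (hmono hik), fun i hi hil y => ?_,
      fun y => ?_, fun i hi => ?_⟩
    · exact (mk_congr (Submodule.comapSubtypeEquivOfLe (hle i hi)).toEquiv).trans (hP i hi.le)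
    · have := mem_biSup_of_monotone hmono (isSuccLimit_pos hil) (y := (y : A))
      rwa [← hx i hi.le hil] at this
    · have := mem_biSup_of_monotone hmono (isSuccLimit_pos ha) (y := (y : A))
      rw [← hx a le_rfl ha] at this
      exact this.1 y.2
    · obtain ⟨h, hu⟩ := hQ i hi
      exact ⟨Submodule.comap_mono h, hu.comap_subtype h (hle _ (ha.succ_lt hi))⟩
  · rw [← hU]
    exact (mk_congr (LinearEquiv.ofInjective (j ∘ₗ Finsupp.lsingle i₀)
      (hj.comp (Finsupp.single_injective i₀))).toEquiv).symm
  · intro i hi X hX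
    obtain ⟨E, hXE, hE, hEinj⟩ := exists_small_injective_submodule hA hlam hR hγ
      (fun N hN => hfew N hN) X hX.le
    obtain ⟨k, hk⟩ := exists_disjoint_single j hj E (by rw [hι]; exact lt_succ_of_le hE)
    have := isUniversalOver_sup hl hXE hX hE hEinj hU.le huniv (j ∘ₗ Finsupp.lsingle k) hk
    exact ⟨_, hXE.trans le_sup_left, this.1.trans hX, _, this⟩
  · intro i hi hil x hx hP
    apply le_antisymm
    · exact mk_biSup_le hx (isSuccLimit_pos hil) hl ((Ordinal.card_le_card hi).trans hal)
        fun k hk => (hP k hk).le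
    · rw [← hP 0 (isSuccLimit_pos hil)]
      exact mk_le_of_injective (Submodule.inclusion_injective
        (le_iSup₂_of_le (f := fun k (_ : k < i) => x k) 0 (isSuccLimit_pos hil) le_rfl))

end ModuleLimit

/-! ### The main theorem -/

theorem corollary3p24 (R : Type u) [Ring R] (lam : Cardinal.{u})
    (hR : Cardinal.mk R ≤ lam)
    (hreg : lam.IsRegular)
    (hgamma : Order.succ (ModuleLimit.gamma R) ≤ lam)
    (hstable : ModuleLimit.IsStableIn R lam) :
    -- for each regular `κ < lam⁺` the `(lam, κ)`-limit model exists
    (∀ κ : Cardinal.{u}, κ.IsRegular → κ < Order.succ lam →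
      ∃ M : ModuleCat.{u} R, ModuleLimit.IsLimitModel R lam κ.ord M) ∧
    -- and is unique up to isomorphism
    (∀ κ : Cardinal.{u}, κ.IsRegular → κ < Order.succ lam →
      ∀ M N : ModuleCat.{u} R, ModuleLimit.IsLimitModel R lam κ.ord M →
        ModuleLimit.IsLimitModel R lam κ.ord N → Nonempty (M ≃ₗ[R] N)) ∧
    {κ : Cardinal.{u} | κ < Order.succ lam ∧ κ.IsRegular ∧
        ModuleLimit.LimitModelsIso R lam κ.ord lam.ord} =
      Set.Ico (ModuleLimit.gamma R) (Order.succ lam) ∩ {κ : Cardinal.{u} | κ.IsRegular} := by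
  have hγ : ModuleLimit.gamma R ≤ lam := (Order.le_succ _).trans hgamma
  have hex : ∀ κ : Cardinal.{u}, κ.IsRegular → κ < Order.succ lam →
      ∃ M : ModuleCat.{u} R, ModuleLimit.IsLimitModel R lam κ.ord M := by
    intro κ hκ hlt
    obtain ⟨M, c, hc⟩ := ModuleLimit.exists_isLimitChain hreg hR hγ hstable
      (Cardinal.isSuccLimit_ord hκ.aleph0_le)
      ((Cardinal.card_ord κ).trans_le (Order.lt_succ_iff.1 hlt))
    exact ⟨M, ModuleLimit.isLimitModel_iff.2 ⟨c, hc⟩⟩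
  refine ⟨hex, fun κ _ _ M N hM hN => ?_, ?_⟩
  · obtain ⟨c, hc⟩ := ModuleLimit.isLimitModel_iff.1 hM
    obtain ⟨d, hd⟩ := ModuleLimit.isLimitModel_iff.1 hN
    exact hc.nonempty_equiv hd
  · ext κ
    constructor
    · rintro ⟨hlt, hκ, M, N, hM, hN, ⟨e⟩⟩
      obtain ⟨c, hc⟩ := ModuleLimit.isLimitModel_iff.1 hM
      obtain ⟨d, hd⟩ := ModuleLimit.isLimitModel_iff.1 hN
      have hNinj := hd.injective hR hreg hγ
      exact ⟨⟨hc.gamma_le_of_injective hR hκ (ModuleLimit.injective_of_retract hNinj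
        e.toLinearMap e.symm.toLinearMap e.symm_apply_apply), hlt⟩, hκ⟩
    · rintro ⟨⟨hle, hlt⟩, hκ⟩
      obtain ⟨M, hM⟩ := hex κ hκ hlt
      obtain ⟨N, hN⟩ := hex lam hreg (Order.lt_succ lam)
      refine ⟨hlt, hκ, M, N, hM, hN, ?_⟩
      obtain ⟨c, hc⟩ := ModuleLimit.isLimitModel_iff.1 hM
      obtain ⟨d, hd⟩ := ModuleLimit.isLimitModel_iff.1 hN
      obtain ⟨f, hf⟩ := hd.exists_embedding hc.mk_le
      obtain ⟨g, hg⟩ := hc.exists_embedding hd.mk_le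
      exact ModuleLimit.nonempty_equiv_of_injective_of_embeddings (hc.injective hR hκ hle)
        (hd.injective hR hreg hγ) f hf g hg
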